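/- Let $\mathsf{AP}$ be a countable set of atomic propositions. The language $\Phi_{\mathsf{XY}}$ is given by $\alpha ::= p \mid \bot \mid \neg\alpha \mid (\alpha\land\alpha) \mid \mathtt{X}\alpha \mid \mathtt{Y}\alpha$ with $p\in\mathsf{AP}$, the language $\Phi_{\mathsf{ConSHN\text{-}BT}}$ by $\phi ::= p \mid \bot \mid \neg\phi \mid (\phi\land\phi) \mid \mathtt{X}\phi \mid \mathtt{Y}\phi \mid [\alpha]\phi$ with $\alpha\in\Phi_{\mathsf{XY}}$, and $\Phi_{\mathsf{PL}}$ is the set of formulas of $\Phi_{\mathsf{XY}}$ without $\mathtt{X}$ and $\mathtt{Y}$. The connectives $\top,\lor,\to,\leftrightarrow$ are defined as usual, $\langle\alpha\rangle\phi := \neg[\alpha]\neg\phi$, $\Box\phi := [\top]\phi$ and $\Diamond\phi := \neg\Box\neg\phi$. Closed formulas are given by $\chi ::= [\alpha]\phi \mid \neg\chi \mid (\chi\land\chi)$ with $\alpha \in \Phi_{\mathsf{XY}}$ and $\phi \in \Phi_{\mathsf{ConSHN\text{-}BT}}$. A model is $\mathtt{M}=(W,<,V)$, where $W$ is a non-empty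 set, $V:\mathsf{AP}\to\mathcal{P}(W)$, and $<$ is a serial relation on $W$ with a root $r\in W$ such that for every $w\in W$ there is exactly one finite sequence $x_0<\dots<x_n$ with $x_0=r$ and $x_n=w$ (here $x_0<\dots<x_n$ means $x_k<x_{k+1}$ for all $k<n$). A timeline is an infinite sequence $\pi=(\pi[0],\pi[1],\dots)$ with $\pi[0]=r$ and $\pi[k]<\pi[k+1]$ for all $k$. A context is a finite set $\mathtt{C}$ of sets of timelines; $\mathrm{AT}(\mathtt{C})$ is the set of the timelines that belong to every element of $\mathtt{C}$ (so $\mathrm{AT}(\emptyset)$ is the set of all timelines). Truth of a formula at a timeline $\pi$ and an instant $i\in\mathbb{N}$ is defined by: $\mathtt{M},\mathtt{C},\pi,i\Vdash p$ iff $\pi[i]\in V(p)$; the usual clauses for $\bot,\neg,\land$; $\mathtt{M},\mathtt{C},\pi,i\Vdash\mathtt{X}\phi$ iff $\mathtt{M},\mathtt{C},\pi,i+1\Vdash\phi$; $\mathtt{M},\mathtt{C},\pi,i\Vdash\mathtt{Y}\phi$ iff $i=0$ or $\mathtt{M},\mathtt{C},\pi,i-1\Vdash\phi$; and $\mathtt{M},\mathtt{C},\pi,i\Vdash[\alpha]\phi$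 iff $\mathtt{M},\mathtt{C}',\pi',i\Vdash\phi$ for every $\pi'\in\mathrm{AT}(\mathtt{C}')$, where $\mathtt{C}'=\mathtt{C}\cup\{\{\pi''\mid \mathtt{M},\mathtt{C},\pi'',i\Vdash\alpha\}\}$. A formula $\phi$ is valid if $\mathtt{M},\mathtt{C},\pi,i\Vdash\phi$ for all models $\mathtt{M}$, contexts $\mathtt{C}$ for $\mathtt{M}$, timelines $\pi\in\mathrm{AT}(\mathtt{C})$ and instants $i$. The axiomatic system $\mathsf{ConSHN\text{-}BT}$ has the following axioms, where $\phi,\psi\in\Phi_{\mathsf{ConSHN\text{-}BT}}$ and, unless said otherwise, $\alpha,\beta,\gamma\in\Phi_{\mathsf{XY}}$: 1. all instances of propositional tautologies; 2. $\mathtt{X}\neg\phi\leftrightarrow\neg\mathtt{X}\phi$; $\ \mathtt{X}(\phi\land\psi)\leftrightarrow(\mathtt{X}\phi\land\mathtt{X}\psi)$; $\ \mathtt{X}\mathtt{Y}\phi\leftrightarrow\phi$; $\ \mathtt{X}[\alpha]\phi\leftrightarrow[\mathtt{X}\alpha]\mathtt{X}\phi$; $\ \neg\mathtt{X}\neg\top$;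 3. $\mathtt{Y}\neg\phi\leftrightarrow(\mathtt{Y}\bot\lor\neg\mathtt{Y}\phi)$; $\ \mathtt{Y}(\phi\land\psi)\leftrightarrow(\mathtt{Y}\phi\land\mathtt{Y}\psi)$; $\ \mathtt{Y}\mathtt{X}\phi\leftrightarrow(\mathtt{Y}\bot\lor\phi)$; $\ \mathtt{Y}[\alpha]\phi\leftrightarrow[\mathtt{Y}\alpha]\mathtt{Y}\phi$; $\ \Diamond\mathtt{Y}\bot\to(\Diamond\alpha\to\alpha)$ for $\alpha\in\Phi_{\mathsf{PL}}$; 4. $[\alpha](\phi\land\psi)\leftrightarrow([\alpha]\phi\land[\alpha]\psi)$; $\ [\alpha](\phi\lor\chi)\leftrightarrow([\alpha]\phi\lor[\alpha]\chi)$ for closed $\chi$; $\ [\alpha][\beta]\gamma\leftrightarrow[\alpha\land\beta]\gamma$; $\ [\alpha]\langle\beta\rangle\gamma\leftrightarrow([\alpha]\bot\lor\langle\alpha\land\beta\rangle\gamma)$; $\ [\alpha]\beta\leftrightarrow\Box(\alpha\to\beta)$; 5. $\Box\alpha\to\alpha$. Its inference rules are: modus ponens; from $\phi$ infer $\mathtt{X}\phi$;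 from $\phi$ infer $\mathtt{Y}\phi$; from $\alpha\in\Phi_{\mathsf{XY}}$ infer $\Box\alpha$; and replacement of equivalents: from $\psi\leftrightarrow\psi'$ infer $\phi\leftrightarrow\phi'$, where the formula $\phi'$ results from the formula $\phi$ by replacing occurrences of its subformula $\psi$ (also occurrences inside antecedents) by $\psi'$. **Theorem.** The system $\mathsf{ConSHN\text{-}BT}$ is sound and complete: a formula $\phi$ of $\Phi_{\mathsf{ConSHN\text{-}BT}}$ is derivable in $\mathsf{ConSHN\text{-}BT}$ if and only if it is valid. -/

import Mathlib

universe u w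

namespace ConSHN

/-! ### Languages -/

/-- The language `Φ_XY` over the set `AP` of atomic propositions. -/
inductive XY (AP : Type u) : Type u
  | atom (p : AP) : XY AP
  | bot : XY AP
  | neg (α : XY AP) : XY AP
  | and (α β : XY AP) : XY AP
  | next (α : XY AP) : XY AP
  | prev (α : XY AP) : XY AP

/-- The language `Φ_ConSHN-BT`: `next` is `X`, `prev` is `Y`, and `con α φ` is `[α]φ`,
whose antecedent `α` is in `Φ_XY`. -/
inductive Form (AP : Type u) : Type u
  | atom (p : AP) : Form AP
  | bot : Form AP
  | neg (φ : Form AP) : Form AP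
  | and (φ ψ : Form AP) : Form AP
  | next (φ : Form AP) : Form AP
  | prev (φ : Form AP) : Form AP
  | con (α : XY AP) (φ : Form AP) : Form AP

variable {AP : Type u}

/-- The inclusion of `Φ_XY` in `Φ_ConSHN-BT`. -/
def XY.toForm : XY AP → Form AP
  | .atom p => .atom p
  | .bot => .bot
  | .neg α => .neg α.toForm
  | .and α β => .and α.toForm β.toForm
  | .next α => .next α.toForm
  | .prev α => .prev α.toForm

/-- `⊤`, as a formula of `Φ_XY`. -/
def XY.top : XY AP := .neg .bot

/-- Membership in the propositional language `Φ_PL`. -/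
def XY.IsPL : XY AP → Prop
  | .atom _ => True
  | .bot => True
  | .neg α => α.IsPL
  | .and α β => α.IsPL ∧ β.IsPL
  | .next _ => False
  | .prev _ => False

namespace Form

/-- `⊤` -/
def top : Form AP := neg bot

/-- `φ ∨ ψ` -/
def or (φ ψ : Form AP) : Form AP := neg (and (neg φ) (neg ψ))

/-- `φ → ψ` -/
def imp (φ ψ : Form AP) : Form AP := neg (and φ (neg ψ))

/-- `φ ↔ ψ` -/
def iff (φ ψ : Form AP) : Form AP := and (imp φ ψ) (imp ψ φ)

/-- The dual `⟨α⟩φ` of `[α]φ`. -/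
def dcon (α : XY AP) (φ : Form AP) : Form AP := neg (con α (neg φ))

/-- `□φ` is `[⊤]φ`. -/
def box (φ : Form AP) : Form AP := con XY.top φ

/-- `◇φ` is `¬□¬φ`. -/
def dia (φ : Form AP) : Form AP := neg (box (neg φ))

/-- Closed formulas: `χ ::= [α]φ | ¬χ | (χ ∧ χ)`. -/
inductive IsClosed : Form AP → Prop
  | con (α : XY AP) (φ : Form AP) : IsClosed (con α φ)
  | neg {χ : Form AP} : IsClosed χ → IsClosed (neg χ)
  | and {χ χ' : Form AP} : IsClosed χ → IsClosed χ' → IsClosed (and χ χ')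

end Form

/-! ### Semantics -/

/-- Models: a serial relation with a root from which every state is reached by exactly one finite
sequence `x₀ < ⋯ < xₙ`, together with a valuation. -/
structure Model (AP : Type u) : Type (max u (w + 1)) where
  /-- The states (non-empty because of `root`). -/
  W : Type w
  /-- The relation `x < y`: the state `x` can evolve to `y` at the next instant. -/
  rel : W → W → Prop
  serial : ∀ x, ∃ y, rel x y
  /-- The root (it is determined by `rel` through the next field). -/
  root : W
  existsUnique_path : ∀ x, ∃! l : List W,
    l.head? = some root ∧ l.getLast? = some x ∧ l.IsChain rel
  /-- The valuation. -/
  V : AP → Set W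

namespace Model

/-- Timelines: infinite sequences `x₀ < x₁ < ⋯` that start at the root. -/
def Timeline (M : Model.{u, w} AP) : Type w :=
  {π : ℕ → M.W // π 0 = M.root ∧ ∀ i, M.rel (π i) (π (i + 1))}

/-- Contexts: finite sets of sets of timelines. -/
def Context (M : Model.{u, w} AP) : Type w :=
  {C : Set (Set M.Timeline) // C.Finite}

variable {M : Model.{u, w} AP}

/-- The timelines that are acceptable by a context: those in all its rules
(all timelines, if the context is empty). -/
def Context.AT (C : M.Context) : Set M.Timeline := ⋂₀ C.1

/-- The result of adding the rule `R` to the context `C`. -/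
def Context.add (C : M.Context) (R : Set M.Timeline) : M.Context :=
  ⟨insert R C.1, C.2.insert R⟩

end Model

/-- Truth of formulas of `Φ_XY` (it involves no context). -/
def XY.Sat (M : Model.{u, w} AP) : XY AP → M.Timeline → ℕ → Prop
  | .atom p, π, i => π.1 i ∈ M.V p
  | .bot, _, _ => False
  | .neg α, π, i => ¬ α.Sat M π i
  | .and α β, π, i => α.Sat M π i ∧ β.Sat M π i
  | .next α, π, i => α.Sat M π (i + 1)
  | .prev α, π, i => 0 < i → α.Sat M π (i - 1)

/-- The rule generated by `α` at the instant `i`. -/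
def rule (M : Model.{u, w} AP) (α : XY AP) (i : ℕ) : Set M.Timeline := {π | α.Sat M π i}

/-- Truth of formulas of `Φ_ConSHN-BT`. -/
def Form.Sat (M : Model.{u, w} AP) : Form AP → M.Context → M.Timeline → ℕ → Prop
  | .atom p, _, π, i => π.1 i ∈ M.V p
  | .bot, _, _, _ => False
  | .neg φ, C, π, i => ¬ φ.Sat M C π i
  | .and φ ψ, C, π, i => φ.Sat M C π i ∧ ψ.Sat M C π i
  | .next φ, C, π, i => φ.Sat M C π (i + 1)
  | .prev φ, C, π, i => 0 < i → φ.Sat M C π (i - 1)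
  | .con α φ, C, _, i =>
      ∀ π' ∈ (C.add (rule M α i)).AT, φ.Sat M (C.add (rule M α i)) π' i

/-- The two truth definitions agree on `Φ_XY`, so that `rule M α i` is the set of timelines at
which `α` is true at `i` (with respect to any context). -/
theorem XY.sat_toForm (M : Model.{u, w} AP) (α : XY AP) (C : M.Context) (π : M.Timeline) (i : ℕ) :
    α.toForm.Sat M C π i ↔ α.Sat M π i := by
  induction α generalizing i with
  | atom p => rfl
  | bot => rfl
  | neg α ih => exact not_congr (ih i)
  | and α β ihα ihβ => exact and_congr (ihα i) (ihβ i)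
  | next α ih => exact ih (i + 1)
  | prev α ih => exact imp_congr_right fun _ => ih (i - 1)

/-- Validity: truth at all contextualized pointed models. -/
def Valid (φ : Form AP) : Prop :=
  ∀ (M : Model.{u, w} AP) (C : M.Context) (π : M.Timeline) (i : ℕ), π ∈ C.AT → φ.Sat M C π i

/-! ### The axiomatic system -/

/-- Instances in the language of propositional tautologies: formulas that are true under every
truth assignment that respects `⊥`, `¬` and `∧` (all other formulas count as atoms). -/
def Form.IsTautology (φ : Form AP) : Prop :=
  ∀ v : Form AP → Prop, ¬ v .bot → (∀ ψ, v (.neg ψ) ↔ ¬ v ψ) →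
    (∀ ψ χ, v (.and ψ χ) ↔ v ψ ∧ v χ) → v φ

/-- `Replace ψ ψ' φ φ'`: the formula `φ'` is the result of replacing occurrences of the subformula
`ψ` of `φ` by `ψ'`, where occurrences in antecedents are included. -/
inductive Replace (ψ ψ' : Form AP) : Form AP → Form AP → Prop
  | here : Replace ψ ψ' ψ ψ'
  | refl (φ : Form AP) : Replace ψ ψ' φ φ
  | neg {φ φ' : Form AP} : Replace ψ ψ' φ φ' → Replace ψ ψ' (.neg φ) (.neg φ')
  | and {φ φ' χ χ' : Form AP} : Replace ψ ψ' φ φ' → Replace ψ ψ' χ χ' →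
      Replace ψ ψ' (.and φ χ) (.and φ' χ')
  | next {φ φ' : Form AP} : Replace ψ ψ' φ φ' → Replace ψ ψ' (.next φ) (.next φ')
  | prev {φ φ' : Form AP} : Replace ψ ψ' φ φ' → Replace ψ ψ' (.prev φ) (.prev φ')
  | con {α α' : XY AP} {φ φ' : Form AP} : Replace ψ ψ' α.toForm α'.toForm →
      Replace ψ ψ' φ φ' → Replace ψ ψ' (.con α φ) (.con α' φ')

open Form in
/-- Derivability in the axiomatic system `ConSHN-BT`. -/
inductive Derivable : Form AP → Prop
  -- Propositional logic
  | taut {φ : Form AP} : φ.IsTautology → Derivable φ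
  -- Axioms for `X`
  | next_neg (φ : Form AP) : Derivable (iff (next (neg φ)) (neg (next φ)))
  | next_and (φ ψ : Form AP) : Derivable (iff (next (and φ ψ)) (and (next φ) (next ψ)))
  | next_prev (φ : Form AP) : Derivable (iff (next (prev φ)) φ)
  | next_con (α : XY AP) (φ : Form AP) :
      Derivable (iff (next (con α φ)) (con (.next α) (next φ)))
  | not_next_not_top : Derivable (neg (next (neg top)))
  -- Axioms for `Y`
  | prev_neg (φ : Form AP) : Derivable (iff (prev (neg φ)) (or (prev bot) (neg (prev φ))))
  | prev_and (φ ψ : Form AP) : Derivable (iff (prev (and φ ψ)) (and (prev φ) (prev ψ)))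
  | prev_next (φ : Form AP) : Derivable (iff (prev (next φ)) (or (prev bot) φ))
  | prev_con (α : XY AP) (φ : Form AP) :
      Derivable (iff (prev (con α φ)) (con (.prev α) (prev φ)))
  | dia_prev_bot (α : XY AP) : α.IsPL →
      Derivable (imp (dia (prev bot)) (imp (dia α.toForm) α.toForm))
  -- Axioms for the partial reduction of `[·]`
  | con_and (α : XY AP) (φ ψ : Form AP) :
      Derivable (iff (con α (and φ ψ)) (and (con α φ) (con α ψ)))
  | con_or (α : XY AP) (φ χ : Form AP) : χ.IsClosed →
      Derivable (iff (con α (or φ χ)) (or (con α φ) (con α χ)))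
  | con_con (α β γ : XY AP) :
      Derivable (iff (con α (con β γ.toForm)) (con (.and α β) γ.toForm))
  | con_dcon (α β γ : XY AP) :
      Derivable (iff (con α (dcon β γ.toForm)) (or (con α bot) (dcon (.and α β) γ.toForm)))
  | con_box (α β : XY AP) : Derivable (iff (con α β.toForm) (box (imp α.toForm β.toForm)))
  -- Axiom for `□`
  | box_imp (α : XY AP) : Derivable (imp (box α.toForm) α.toForm)
  -- Inference rules
  | modus_ponens {φ ψ : Form AP} : Derivable φ → Derivable (imp φ ψ) → Derivable ψ
  | gen_next {φ : Form AP} : Derivable φ → Derivable (next φ)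
  | gen_prev {φ : Form AP} : Derivable φ → Derivable (prev φ)
  | gen_box {α : XY AP} : Derivable α.toForm → Derivable (box α.toForm)
  | replacement {ψ ψ' φ φ' : Form AP} : Derivable (iff ψ ψ') → Replace ψ ψ' φ φ' →
      Derivable (iff φ φ')

end ConSHN

namespace ConSHN

variable {AP : Type u}

/-! ### Soundness -/

/-! Soundness is an induction on derivations; the delicate rule is replacement inside antecedents
(`Replace.sat_congr`).

For completeness, by Lindenbaum it suffices that a valid formula holds under every valuation `v`
given by a maximal consistent set (`derivable_of_forall_isVal`). The reduction axioms turn any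
formula into a decision tree with tests `□β` and leaves in `Φ_XY` (`Form.exists_tree`), so only
finitely many `□β`, none nested, have to be evaluated. Each one that fails under `v` is refuted by a
valuation accessible from `v` (`IsVal.exists_witnesses`).

These valuations become the branches of a tree that splits only at its root, all read at one instant
`i`: instant `k` of a branch is described by `Yⁱ Xᵏ`. If `v` satisfies some `Yⁿ⊥`, then `i` is the
instant that `v` determines, and the branches agree on atoms at the root by the axiom on `◇Y⊥`.
Otherwise `v` sees an endless past, and `i` is taken larger than the `Y`-depth of the decision tree,
so that the root is never inspected. In the empty context `□` ranges over exactly the branches,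
which gives the truth lemma. -/

theorem Model.Context.mem_add_AT {M : Model.{u, w} AP} (C : M.Context) (R : Set M.Timeline)
    (π : M.Timeline) : π ∈ (C.add R).AT ↔ π ∈ R ∧ π ∈ C.AT := by
  simp [Model.Context.AT, Model.Context.add]

/-- Truth depends on a context only through the timelines that it accepts. -/
theorem Form.sat_congr_AT {M : Model.{u, w} AP} (φ : Form AP) {C D : M.Context}
    (h : C.AT = D.AT) (π : M.Timeline) (i : ℕ) : φ.Sat M C π i ↔ φ.Sat M D π i := by
  induction φ generalizing C D π i with
  | atom p => rfl
  | bot => rfl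
  | neg φ ih => exact not_congr (ih h π i)
  | and φ ψ ih₁ ih₂ => exact and_congr (ih₁ h π i) (ih₂ h π i)
  | next φ ih => exact ih h π (i + 1)
  | prev φ ih => exact imp_congr_right fun _ => ih h π (i - 1)
  | con α φ ih =>
    have h' : (C.add (rule M α i)).AT = (D.add (rule M α i)).AT := by
      ext π'; simp only [Model.Context.mem_add_AT, h]
    simp only [Form.Sat]
    rw [h']
    exact forall₂_congr fun π' _ => ih h' π' i

section SatConnectives

variable {M : Model.{u, w} AP} {C : M.Context} {π : M.Timeline} {i : ℕ}

theorem Form.sat_imp {φ ψ : Form AP} :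
    (Form.imp φ ψ).Sat M C π i ↔ (φ.Sat M C π i → ψ.Sat M C π i) := by
  simp [Form.imp, Form.Sat]

theorem Form.sat_or {φ ψ : Form AP} :
    (Form.or φ ψ).Sat M C π i ↔ (φ.Sat M C π i ∨ ψ.Sat M C π i) := by
  simp only [Form.or, Form.Sat]; tauto

theorem Form.sat_iff {φ ψ : Form AP} :
    (Form.iff φ ψ).Sat M C π i ↔ (φ.Sat M C π i ↔ ψ.Sat M C π i) := by
  simp only [Form.iff, Form.Sat, Form.sat_imp]; tauto

theorem Form.sat_con {α : XY AP} {φ : Form AP} : (Form.con α φ).Sat M C π i ↔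
    ∀ π', α.Sat M π' i → π' ∈ C.AT → φ.Sat M (C.add (rule M α i)) π' i := by
  simp only [Form.Sat, Model.Context.mem_add_AT, and_imp]
  rfl

theorem Form.sat_dcon {α : XY AP} {φ : Form AP} : (Form.dcon α φ).Sat M C π i ↔
    ∃ π', α.Sat M π' i ∧ π' ∈ C.AT ∧ φ.Sat M (C.add (rule M α i)) π' i := by
  change ¬ (Form.con α (Form.neg φ)).Sat M C π i ↔ _
  rw [Form.sat_con]
  push Not
  exact exists_congr fun π' => and_congr_right fun _ => and_congr_right fun _ => not_not

theorem Form.sat_con_xy {α β : XY AP} : (Form.con α β.toForm).Sat M C π i ↔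
    ∀ π', α.Sat M π' i → π' ∈ C.AT → β.Sat M π' i := by
  simp only [Form.sat_con, XY.sat_toForm]

theorem Form.sat_box_xy {β : XY AP} : (Form.box β.toForm).Sat M C π i ↔
    ∀ π' ∈ C.AT, β.Sat M π' i := by
  simp [Form.box, Form.sat_con_xy, XY.top, XY.Sat]

theorem Form.sat_dia_xy {β : XY AP} : (Form.dia β.toForm).Sat M C π i ↔
    ∃ π' ∈ C.AT, β.Sat M π' i := by
  have := Form.sat_box_xy (M := M) (C := C) (π := π) (i := i) (β := XY.neg β)
  change ¬ (Form.box (XY.neg β).toForm).Sat M C π i ↔ _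
  rw [this]
  simp [XY.Sat]

end SatConnectives

/-- The modality `[α]` quantifies over timelines afresh, so the current one is forgotten. -/
theorem Form.IsClosed.sat_congr {M : Model.{u, w} AP} {χ : Form AP} (h : χ.IsClosed)
    (C : M.Context) (π π' : M.Timeline) (i : ℕ) : χ.Sat M C π i ↔ χ.Sat M C π' i := by
  induction h with
  | con α φ => rfl
  | neg _ ih => exact not_congr ih
  | and _ _ ih₁ ih₂ => exact and_congr ih₁ ih₂

theorem XY.IsPL.sat_zero {M : Model.{u, w} AP} {α : XY AP} (h : α.IsPL) (π π' : M.Timeline) :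
    α.Sat M π 0 ↔ α.Sat M π' 0 := by
  induction α with
  | atom p => simp only [XY.Sat, π.2.1, π'.2.1]
  | bot => rfl
  | neg α ih => exact not_congr (ih h)
  | and α β ih₁ ih₂ => exact and_congr (ih₁ h.1) (ih₂ h.2)
  | next α _ => exact h.elim
  | prev α _ => exact h.elim

/-- Equivalents need to agree only on acceptable timelines. Replacing an antecedent may thus change
the added rule, but not which timelines of `C.AT` satisfy it; `Form.sat_congr_AT` shows that this is
enough. -/
theorem Replace.sat_congr {M : Model.{u, w} AP} {ψ ψ' φ φ' : Form AP} (hr : Replace ψ ψ' φ φ')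
    (h : Valid.{u, w} (Form.iff ψ ψ')) (C : M.Context) (π : M.Timeline) (i : ℕ)
    (hπ : π ∈ C.AT) : φ.Sat M C π i ↔ φ'.Sat M C π i := by
  induction hr generalizing C π i with
  | here => exact Form.sat_iff.1 (h M C π i hπ)
  | refl φ => rfl
  | neg _ ih => exact not_congr (ih C π i hπ)
  | and _ _ ih₁ ih₂ => exact and_congr (ih₁ C π i hπ) (ih₂ C π i hπ)
  | next _ ih => exact ih C π (i + 1) hπ
  | prev _ ih => exact imp_congr_right fun _ => ih C π (i - 1) hπ
  | @con α α' φ φ' _ _ ihα ihφ =>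
    have hAT : (C.add (rule M α i)).AT = (C.add (rule M α' i)).AT := by
      ext π'
      simp only [Model.Context.mem_add_AT]
      refine and_congr_left fun hπ' => ?_
      have := ihα C π' i hπ'
      rwa [XY.sat_toForm, XY.sat_toForm] at this
    change (∀ π' ∈ _, _) ↔ (∀ π' ∈ _, _)
    rw [← hAT]
    refine forall₂_congr fun π' hπ' => ?_
    rw [ihφ _ π' i hπ']
    exact Form.sat_congr_AT φ' hAT π' i

theorem Form.IsTautology.sat {M : Model.{u, w} AP} {φ : Form AP} (h : φ.IsTautology)
    (C : M.Context) (π : M.Timeline) (i : ℕ) : φ.Sat M C π i :=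
  h (fun ψ => ψ.Sat M C π i) (fun h => h) (fun _ => Iff.rfl) fun _ _ => Iff.rfl

theorem Derivable.valid {φ : Form AP} (h : Derivable φ) : Valid.{u, w} φ := by
  induction h with
  | taut h => exact fun M C π i _ => h.sat C π i
  | next_neg φ => intro M C π i _; rw [Form.sat_iff]; rfl
  | next_and φ ψ => intro M C π i _; rw [Form.sat_iff]; rfl
  | next_prev φ => intro M C π i _; rw [Form.sat_iff]; simp [Form.Sat]
  | next_con α φ => intro M C π i _; rw [Form.sat_iff]; rfl
  | not_next_not_top => intro M C π i _; simp [Form.Sat, Form.top]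
  | prev_neg φ =>
    intro M C π i _; rw [Form.sat_iff, Form.sat_or]
    simp only [Form.Sat]; tauto
  | prev_and φ ψ =>
    intro M C π i _; rw [Form.sat_iff]
    simp only [Form.Sat]; tauto
  | prev_next φ =>
    intro M C π i _; rw [Form.sat_iff, Form.sat_or]
    rcases i with _ | i <;> simp [Form.Sat]
  | prev_con α φ =>
    intro M C π i _; rw [Form.sat_iff]
    rcases i with _ | i
    · simp [Form.Sat]
    · have hr : rule M (.prev α) (i + 1) = rule M α i := by simp [rule, XY.Sat]
      simp [Form.Sat, hr]
  | dia_prev_bot α hα =>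
    intro M C π i _
    rw [Form.sat_imp, Form.sat_imp, XY.sat_toForm]
    intro h₁ h₂
    have h₁ := (Form.sat_dia_xy (β := XY.prev .bot)).1 h₁
    obtain ⟨_, _, h₁⟩ := h₁
    obtain ⟨π', _, h₂⟩ := Form.sat_dia_xy.1 h₂
    rcases i with _ | i
    · exact (hα.sat_zero π' π).1 h₂
    · exact (h₁ i.succ_pos).elim
  | con_and α φ ψ =>
    intro M C π i _; rw [Form.sat_iff]
    simp only [Form.Sat]
    exact ⟨fun h => ⟨fun π' hπ' => (h π' hπ').1, fun π' hπ' => (h π' hπ').2⟩,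
      fun h π' hπ' => ⟨h.1 π' hπ', h.2 π' hπ'⟩⟩
  | con_or α φ χ hχ =>
    intro M C π i _; rw [Form.sat_iff, Form.sat_or]
    simp only [Form.sat_con, Form.sat_or]
    constructor
    · intro h
      -- Refute `φ` at one timeline and `χ` at another; as `χ` is closed, it then fails at the first
      -- one too.
      by_contra hc
      push Not at hc
      obtain ⟨⟨π₁, a₁, b₁, c₁⟩, π₂, a₂, b₂, c₂⟩ := hc
      rcases h π₁ a₁ b₁ with h | h
      · exact c₁ h
      · exact c₂ ((hχ.sat_congr _ π₁ π₂ i).1 h)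
    · rintro (h | h) π' a b
      · exact Or.inl (h π' a b)
      · exact Or.inr (h π' a b)
  | con_con α β γ =>
    intro M C π i _; rw [Form.sat_iff, Form.sat_con, Form.sat_con_xy]
    simp only [Form.sat_con_xy, Model.Context.mem_add_AT, XY.Sat]
    exact ⟨fun h π' a b => h π' a.1 b π' a.2 ⟨a.1, b⟩,
      fun h _ _ _ π'' c d => h π'' ⟨d.1, c⟩ d.2⟩
  | con_dcon α β γ =>
    intro M C π i _; rw [Form.sat_iff, Form.sat_or, Form.sat_con, Form.sat_con, Form.sat_dcon]
    simp only [Form.sat_dcon, XY.sat_toForm, Model.Context.mem_add_AT, XY.Sat, Form.Sat]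
    constructor
    · intro h
      by_cases hc : ∃ π', α.Sat M π' i ∧ π' ∈ C.AT
      · obtain ⟨π', a, b⟩ := hc
        obtain ⟨π'', c, d, e⟩ := h π' a b
        exact Or.inr ⟨π'', ⟨d.1, c⟩, d.2, e⟩
      · exact Or.inl fun π' a b => hc ⟨π', a, b⟩
    · rintro (h | ⟨π'', a, b, c⟩) π' a' b'
      · exact (h π' a' b').elim
      · exact ⟨π'', a.2, ⟨a.1, b⟩, c⟩
  | con_box α β =>
    intro M C π i _; rw [Form.sat_iff, Form.sat_con_xy]
    have := Form.sat_box_xy (M := M) (C := C) (π := π) (i := i) (β := .neg (.and α (.neg β)))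
    change _ ↔ (Form.box (XY.neg (.and α (.neg β))).toForm).Sat M C π i
    rw [this]
    simp only [XY.Sat]
    exact forall_congr' fun π' => by tauto
  | box_imp α =>
    intro M C π i hπ; rw [Form.sat_imp, Form.sat_box_xy, XY.sat_toForm]
    exact fun h => h π hπ
  | modus_ponens _ _ ih₁ ih₂ =>
    exact fun M C π i hπ => Form.sat_imp.1 (ih₂ M C π i hπ) (ih₁ M C π i hπ)
  | gen_next _ ih => exact fun M C π i hπ => ih M C π (i + 1) hπ
  | gen_prev _ ih => exact fun M C π i hπ _ => ih M C π (i - 1) hπ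
  | gen_box _ ih =>
    intro M C π i _
    rw [Form.sat_box_xy]
    exact fun π' hπ' => (XY.sat_toForm M _ C π' i).1 (ih M C π' i hπ')
  | replacement _ hr ih =>
    exact fun M C π i hπ => Form.sat_iff.2 (hr.sat_congr ih C π i hπ)

/-! ### Consistent valuations -/

/-- Truth assignments (to all formulas) that respect the connectives and verify every derivable
formula: characteristic functions of maximal consistent sets. -/
structure IsVal (v : Form AP → Prop) : Prop where
  der {φ : Form AP} : Derivable φ → v φ
  bot : ¬ v .bot
  neg {φ : Form AP} : v (.neg φ) ↔ ¬ v φ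
  and {φ ψ : Form AP} : v (.and φ ψ) ↔ v φ ∧ v ψ

namespace IsVal

variable {v : Form AP → Prop}

theorem imp (hv : IsVal v) {φ ψ : Form AP} : v (.imp φ ψ) ↔ (v φ → v ψ) := by
  simp [Form.imp, hv.neg, hv.and]

theorem or (hv : IsVal v) {φ ψ : Form AP} : v (.or φ ψ) ↔ (v φ ∨ v ψ) := by
  simp only [Form.or, hv.neg, hv.and]; tauto

theorem iff (hv : IsVal v) {φ ψ : Form AP} : v (.iff φ ψ) ↔ (v φ ↔ v ψ) := by
  simp only [Form.iff, hv.and, hv.imp]; tauto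

theorem of_iff (hv : IsVal v) {φ ψ : Form AP} (h : Derivable (.iff φ ψ)) : v φ ↔ v ψ :=
  hv.iff.1 (hv.der h)

end IsVal

/-- Sets of formulas that contain the derivable formulas and are closed under modus ponens. -/
structure IsTheory (T : Set (Form AP)) : Prop where
  der {φ : Form AP} : Derivable φ → φ ∈ T
  mp {φ ψ : Form AP} : φ ∈ T → Form.imp φ ψ ∈ T → ψ ∈ T

/-- Supplying the clause for `→` reduces each propositional fact below to a call of `tauto`. -/
theorem Form.isTautology_of_forall {φ : Form AP}
    (h : ∀ v : Form AP → Prop, (∀ ψ χ, v (.imp ψ χ) ↔ (v ψ → v χ)) → ¬ v .bot →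
      (∀ ψ, v (.neg ψ) ↔ ¬ v ψ) → (∀ ψ χ, v (.and ψ χ) ↔ v ψ ∧ v χ) → v φ) : φ.IsTautology :=
  fun v hb hn ha => h v (fun ψ χ => by simp [Form.imp, hn, ha]) hb hn ha

theorem IsTheory.taut {T : Set (Form AP)} (hT : IsTheory T) {φ : Form AP}
    (h : ∀ v : Form AP → Prop, (∀ ψ χ, v (.imp ψ χ) ↔ (v ψ → v χ)) → ¬ v .bot →
      (∀ ψ, v (.neg ψ) ↔ ¬ v ψ) → (∀ ψ χ, v (.and ψ χ) ↔ v ψ ∧ v χ) → v φ) : φ ∈ T :=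
  hT.der (.taut (Form.isTautology_of_forall h))

/-- Lindenbaum's lemma. -/
theorem IsTheory.exists_isVal {T : Set (Form AP)} (hT : IsTheory T) {φ : Form AP} (hφ : φ ∉ T) :
    ∃ v : Form AP → Prop, IsVal v ∧ (∀ ψ ∈ T, v ψ) ∧ ¬ v φ := by
  obtain ⟨m, hTm, hm⟩ := zorn_subset_nonempty {S : Set (Form AP) | IsTheory S ∧ φ ∉ S}
    (by
      intro c hc hch ⟨S₀, hS₀⟩
      refine ⟨⋃₀ c, ⟨⟨fun h => ⟨S₀, hS₀, (hc hS₀).1.der h⟩, ?_⟩, ?_⟩,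
        fun s hs => Set.subset_sUnion_of_mem hs⟩
      · rintro ψ χ ⟨A, hA, hψ⟩ ⟨B, hB, hi⟩
        rcases hch.total hA hB with h | h
        · exact ⟨B, hB, (hc hB).1.mp (h hψ) hi⟩
        · exact ⟨A, hA, (hc hA).1.mp hψ (h hi)⟩
      · rintro ⟨A, hA, h⟩
        exact (hc hA).2 h) T ⟨hT, hφ⟩
  obtain ⟨⟨hth, hnot⟩, hmax⟩ := hm
  -- If `ψ → φ` were not in `m`, the consequences of `m` together with `ψ` would form a theory that
  -- omits `φ`, against maximality.
  have key : ∀ ψ, ψ ∉ m → Form.imp ψ φ ∈ m := by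
    intro ψ hψ
    by_contra hcon
    have hS : {χ | Form.imp ψ χ ∈ m} ∈ {S : Set (Form AP) | IsTheory S ∧ φ ∉ S} := by
      refine ⟨⟨fun {χ} h => hth.mp (hth.der h) (hth.taut ?_), fun {χ ξ} h₁ h₂ =>
        hth.mp h₁ (hth.mp h₂ (hth.taut ?_))⟩, hcon⟩
      · intro v hi _ _ _; simp only [hi]; tauto
      · intro v hi _ _ _; simp only [hi]; tauto
    refine hψ (hmax hS (fun χ hχ => hth.mp hχ (hth.taut ?_)) (hth.taut ?_))
    · intro v hi _ _ _; simp only [hi]; tauto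
    · intro v hi _ _ _; simp only [hi]; tauto
  refine ⟨(· ∈ m), ⟨hth.der, ?_, ?_, ?_⟩, fun ψ hψ => hTm hψ, hnot⟩
  · exact fun h => hnot (hth.mp h (hth.taut fun v hi hb _ _ => by simp only [hi]; tauto))
  · intro ψ
    constructor
    · exact fun h₁ h₂ => hnot (hth.mp h₁ (hth.mp h₂
        (hth.taut fun v hi _ hn _ => by simp only [hi, hn]; tauto)))
    · intro h
      by_contra h'
      exact hnot (hth.mp (key _ h) (hth.mp (key _ h')
        (hth.taut fun v hi _ hn _ => by simp only [hi, hn]; tauto)))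
  · intro ψ χ
    constructor
    · exact fun h => ⟨hth.mp h (hth.taut fun v hi _ _ ha => by simp only [hi, ha]; tauto),
        hth.mp h (hth.taut fun v hi _ _ ha => by simp only [hi, ha]; tauto)⟩
    · exact fun h => hth.mp h.1 (hth.mp h.2
        (hth.taut fun v hi _ _ ha => by simp only [hi, ha]; tauto))

theorem isTheory_derivable : IsTheory {φ : Form AP | Derivable φ} :=
  ⟨fun h => h, fun h₁ h₂ => .modus_ponens h₁ h₂⟩

/-- Lindenbaum's lemma for the least theory; it replaces Hilbert-style derivations by reasoning
about valuations. -/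
theorem derivable_of_forall_isVal {φ : Form AP} (h : ∀ v, IsVal v → v φ) : Derivable φ := by
  by_contra hφ
  obtain ⟨v, hv, -, hvφ⟩ := isTheory_derivable.exists_isVal hφ
  exact hvφ (h v hv)

/-! ### Provable equivalence -/

/-- Provable equivalence. -/
def ProvEquiv (φ ψ : Form AP) : Prop := Derivable (Form.iff φ ψ)

theorem ProvEquiv.of_isVal {φ ψ : Form AP} (h : ∀ v, IsVal v → (v φ ↔ v ψ)) : ProvEquiv φ ψ :=
  derivable_of_forall_isVal fun v hv => hv.iff.2 (h v hv)

namespace ProvEquiv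

variable {φ ψ χ φ' ψ' : Form AP}

theorem val (h : ProvEquiv φ ψ) {v : Form AP → Prop} (hv : IsVal v) : v φ ↔ v ψ := hv.of_iff h

theorem symm (h : ProvEquiv φ ψ) : ProvEquiv ψ φ := of_isVal fun _ hv => (h.val hv).symm

theorem trans (h : ProvEquiv φ ψ) (h' : ProvEquiv ψ χ) : ProvEquiv φ χ :=
  of_isVal fun _ hv => (h.val hv).trans (h'.val hv)

theorem neg (h : ProvEquiv φ ψ) : ProvEquiv (.neg φ) (.neg ψ) :=
  Derivable.replacement h (.neg .here)

theorem next (h : ProvEquiv φ ψ) : ProvEquiv (.next φ) (.next ψ) :=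
  Derivable.replacement h (.next .here)

theorem prev (h : ProvEquiv φ ψ) : ProvEquiv (.prev φ) (.prev ψ) :=
  Derivable.replacement h (.prev .here)

theorem and (h : ProvEquiv φ ψ) (h' : ProvEquiv φ' ψ') :
    ProvEquiv (.and φ φ') (.and ψ ψ') :=
  of_isVal fun _ hv => by rw [hv.and, hv.and, h.val hv, h'.val hv]

theorem con_right (α : XY AP) (h : ProvEquiv φ ψ) : ProvEquiv (.con α φ) (.con α ψ) :=
  Derivable.replacement h (.con (.refl _) .here)

theorem con_left {α β : XY AP} (h : ProvEquiv α.toForm β.toForm) (φ : Form AP) :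
    ProvEquiv (.con α φ) (.con β φ) :=
  Derivable.replacement h (.con .here (.refl _))

end ProvEquiv

/-- Implication in `Φ_XY`. -/
def XY.imp (α β : XY AP) : XY AP := .neg (.and α (.neg β))

/-! ### Laws of `[α]`, `□`, `X` and `Y` under valuations -/

section Modal

variable {v : Form AP → Prop}

theorem IsVal.top (hv : IsVal v) : v XY.top.toForm := hv.neg.2 hv.bot

theorem IsVal.con_and (hv : IsVal v) (α : XY AP) (φ ψ : Form AP) :
    v (.con α (.and φ ψ)) ↔ v (.con α φ) ∧ v (.con α ψ) :=
  (hv.of_iff (.con_and α φ ψ)).trans hv.and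

/-- Replacement of `φ` by the equivalent `φ ∧ ψ` under `[α]`, followed by distribution over `∧`. -/
theorem IsVal.con_mono (hv : IsVal v) (α : XY AP) {φ ψ : Form AP}
    (h : ∀ v, IsVal v → v φ → v ψ) (hφ : v (.con α φ)) : v (.con α ψ) := by
  have e : ProvEquiv φ (.and φ ψ) := .of_isVal fun v hv => by
    rw [hv.and]; exact ⟨fun a => ⟨a, h v hv a⟩, And.left⟩
  exact ((hv.con_and α φ ψ).1 (((e.con_right α).val hv).1 hφ)).2

theorem IsVal.con_of_con_bot (hv : IsVal v) {α : XY AP} (h : v (.con α .bot)) (φ : Form AP) :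
    v (.con α φ) :=
  hv.con_mono α (fun _ hv hb => (hv.bot hb).elim) h

/-- The necessitation rule covers `Φ_XY` only; monotonicity extends it from `□⊤` to all formulas. -/
theorem IsVal.box_of_derivable (hv : IsVal v) {φ : Form AP} (h : Derivable φ) : v (.box φ) :=
  hv.con_mono XY.top (fun _ hv _ => hv.der h)
    (hv.der (.gen_box (derivable_of_forall_isVal fun _ hv => hv.top)))

theorem IsVal.not_box_bot (hv : IsVal v) : ¬ v (.box .bot) := fun h =>
  hv.bot (hv.imp.1 (hv.der (.box_imp (.bot : XY AP))) h)

theorem ProvEquiv.box {φ ψ : Form AP} (h : ProvEquiv φ ψ) : ProvEquiv (.box φ) (.box ψ) :=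
  h.con_right _

theorem isTheory_box (hv : IsVal v) : IsTheory {φ | v (.box φ)} where
  der h := hv.box_of_derivable h
  mp {φ ψ} h₁ h₂ := hv.con_mono XY.top (φ := .and φ (.imp φ ψ))
    (fun _ hv h => hv.imp.1 (hv.and.1 h).2 (hv.and.1 h).1) ((hv.con_and _ _ _).2 ⟨h₁, h₂⟩)

theorem IsVal.next (hv : IsVal v) : IsVal fun φ => v (.next φ) where
  der h := hv.der (.gen_next h)
  bot h := by
    have e : ProvEquiv (Form.bot : Form AP) (.neg .top) := .of_isVal fun v hv => by
      simp [Form.top, hv.neg]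
    exact hv.neg.1 (hv.der .not_next_not_top) ((e.next.val hv).1 h)
  neg {φ} := (hv.of_iff (.next_neg φ)).trans hv.neg
  and {φ ψ} := (hv.of_iff (.next_and φ ψ)).trans hv.and

theorem IsVal.prev_of_prev_bot (hv : IsVal v) (h : v (.prev .bot)) (φ : Form AP) :
    v (.prev φ) := by
  have e : ProvEquiv (Form.bot : Form AP) (.and .bot φ) := .of_isVal fun v hv => by
    simp [hv.and, hv.bot]
  exact (hv.and.1 ((hv.of_iff (.prev_and .bot φ)).1 ((e.prev.val hv).1 h))).2

/-- Only at the first instant, where `Y⊥` holds, does `Y` fail to commute with negation. -/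
theorem IsVal.prev (hv : IsVal v) (h : ¬ v (.prev .bot)) : IsVal fun φ => v (.prev φ) where
  der h := hv.der (.gen_prev h)
  bot := h
  neg {φ} := by
    rw [hv.of_iff (.prev_neg φ), hv.or, hv.neg]; tauto
  and {φ ψ} := (hv.of_iff (.prev_and φ ψ)).trans hv.and

theorem provEquiv_next_box (φ : Form AP) : ProvEquiv (.next (.box φ)) (.box (.next φ)) :=
  ProvEquiv.trans (Derivable.next_con _ φ) <|
    ProvEquiv.con_left (α := .next .top) (β := .top) (.of_isVal fun _ hv =>
    iff_of_true (hv.der (.gen_next (derivable_of_forall_isVal fun _ hv => hv.top))) hv.top) _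

theorem provEquiv_prev_box (φ : Form AP) : ProvEquiv (.prev (.box φ)) (.box (.prev φ)) :=
  ProvEquiv.trans (Derivable.prev_con _ φ) <|
    ProvEquiv.con_left (α := .prev .top) (β := .top) (.of_isVal fun _ hv =>
    iff_of_true (hv.der (.gen_prev (derivable_of_forall_isVal fun _ hv => hv.top))) hv.top) _

theorem provEquiv_con_box (α β : XY AP) :
    ProvEquiv (.con α (.box β.toForm)) (.box (α.imp β).toForm) :=
  (ProvEquiv.trans (Derivable.con_con α XY.top β) <| ProvEquiv.con_left (α := .and α .top) (β := α)
    (.of_isVal fun _ hv => hv.and.trans (and_iff_left hv.top)) _).trans (Derivable.con_box α β)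

/-- This is the axiom for `[α]⟨⊤⟩¬β`, up to double negations and `α ∧ ⊤ ↔ α`. -/
theorem IsVal.con_neg_box (hv : IsVal v) (α β : XY AP) :
    v (.con α (.neg (.box β.toForm))) ↔ v (.con α .bot) ∨ ¬ v (.box (α.imp β).toForm) := by
  have dn : ProvEquiv β.toForm (.neg (.neg β.toForm)) := .of_isVal fun v hv => by
    simp [hv.neg]
  have e₁ := ((dn.box.neg.con_right α).val hv).trans (hv.of_iff (.con_dcon α XY.top (.neg β)))
  have e₂ : v (.con (.and α XY.top) (.neg (.neg β.toForm))) ↔ v (.box (α.imp β).toForm) :=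
    ((dn.symm.con_right _).trans <| (ProvEquiv.con_left (α := .and α .top) (β := α)
      (.of_isVal fun _ hv => hv.and.trans (and_iff_left hv.top)) _).trans
      (Derivable.con_box α β)).val hv
  rw [e₁, hv.or, Form.dcon, hv.neg]
  exact or_congr_right (not_congr e₂)

end Modal

/-! ### Normal forms -/

/-- Decision trees whose tests are formulas `□β`, with leaves in `Φ_XY`. -/
inductive Tree (AP : Type u) : Type u
  | leaf (γ : XY AP) : Tree AP
  | node (β : XY AP) (s t : Tree AP) : Tree AP

namespace Tree

/-- The formula that evaluates a decision tree. -/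
def toForm : Tree AP → Form AP
  | leaf γ => γ.toForm
  | node β s t => .and (.or s.toForm (.neg (.box β.toForm))) (.or t.toForm (.box β.toForm))

/-- Apply `f` to the leaves and `g` to the tests. -/
def map (f g : XY AP → XY AP) : Tree AP → Tree AP
  | leaf γ => leaf (f γ)
  | node β s t => node (g β) (s.map f g) (t.map f g)

/-- The conjunction of decision trees. -/
def and : Tree AP → Tree AP → Tree AP
  | leaf γ, t => t.map (.and γ) id
  | node β s s', t => node β (s.and t) (s'.and t)

/-- The decision tree of `[α]t`. -/
def con (α : XY AP) : Tree AP → Tree AP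
  -- `[α]γ` amounts to `□(α → γ)`, so it becomes a test with constant outcomes.
  | leaf γ => node (α.imp γ) (leaf .top) (leaf .bot)
  | node β s t => node (α.imp β) (s.con α) (t.con α)

variable {v : Form AP → Prop}

theorem val_node (hv : IsVal v) (β : XY AP) (s t : Tree AP) : v (node β s t).toForm ↔
    (v (.box β.toForm) → v s.toForm) ∧ (¬ v (.box β.toForm) → v t.toForm) := by
  simp only [toForm, hv.and, hv.or, hv.neg]; tauto

theorem val_map_neg (hv : IsVal v) (t : Tree AP) :
    v (t.map .neg id).toForm ↔ ¬ v t.toForm := by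
  induction t with
  | leaf γ => exact hv.neg
  | node β s t ihs iht =>
    rw [map, val_node hv, val_node hv, ihs, iht, id]; tauto

theorem val_map_and (hv : IsVal v) (γ : XY AP) (t : Tree AP) :
    v (t.map (.and γ) id).toForm ↔ v γ.toForm ∧ v t.toForm := by
  induction t with
  | leaf γ => exact hv.and
  | node β s t ihs iht =>
    rw [map, val_node hv, val_node hv, ihs, iht, id]; tauto

theorem val_and (hv : IsVal v) (s t : Tree AP) :
    v (s.and t).toForm ↔ v s.toForm ∧ v t.toForm := by
  induction s with
  | leaf γ => exact val_map_and hv γ t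
  | node β s s' ihs ihs' =>
    rw [and, val_node hv, val_node hv, ihs, ihs']; tauto

theorem val_map_next (hv : IsVal v) (t : Tree AP) :
    v (t.map .next .next).toForm ↔ v (.next t.toForm) := by
  induction t with
  | leaf γ => rfl
  | node β s t ihs iht =>
    have e := val_node hv.next β s t
    rw [map, val_node hv, ihs, iht, e, (provEquiv_next_box β.toForm).val hv]
    rfl

theorem val_map_prev (hv : IsVal v) (t : Tree AP) :
    v (t.map .prev .prev).toForm ↔ v (.prev t.toForm) := by
  induction t with
  | leaf γ => rfl
  | node β s t ihs iht =>
    rw [map, val_node hv, ihs, iht]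
    by_cases h : v (.prev .bot)
    · have := hv.prev_of_prev_bot h
      simp [this]
    · have e := val_node (hv.prev h) β s t
      rw [e, (provEquiv_prev_box β.toForm).val hv]
      rfl

/-- Tests are closed, so `[α]` distributes over the disjunctions of a node and turns the test `□β`
into `□(α → β)`. The extra disjunct `[α]⊥` is absorbed, since it implies `[α]s`. -/
theorem val_con (hv : IsVal v) (α : XY AP) (t : Tree AP) :
    v (t.con α).toForm ↔ v (.con α t.toForm) := by
  induction t with
  | leaf γ =>
    rw [con, val_node hv, toForm, toForm, toForm, hv.of_iff (.con_box α γ)]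
    have h₁ := hv.top
    have h₂ : ¬ v (XY.bot : XY AP).toForm := hv.bot
    change (v (.box (.imp α.toForm γ.toForm)) → _) ∧ (¬ v (.box (.imp α.toForm γ.toForm)) → _) ↔ _
    tauto
  | node β s t ihs iht =>
    have hc : (Form.box β.toForm).IsClosed := .con _ _
    rw [con, val_node hv, ihs, iht]
    have hb := fun h => hv.con_of_con_bot (α := α) h s.toForm
    conv_rhs => rw [toForm]
    rw [hv.con_and, hv.of_iff (.con_or α s.toForm _ hc.neg), hv.of_iff (.con_or α t.toForm _ hc),
      hv.or, hv.or, hv.con_neg_box, (provEquiv_con_box α β).val hv]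
    tauto

end Tree

/-- Every formula is provably equivalent to a decision tree. -/
theorem Form.exists_tree (φ : Form AP) : ∃ t : Tree AP, ProvEquiv φ t.toForm := by
  induction φ with
  | atom p => exact ⟨.leaf (.atom p), .of_isVal fun _ _ => Iff.rfl⟩
  | bot => exact ⟨.leaf .bot, .of_isVal fun _ _ => Iff.rfl⟩
  | neg φ ih =>
    obtain ⟨t, ht⟩ := ih
    exact ⟨_, .of_isVal fun v hv =>
      hv.neg.trans ((not_congr (ht.val hv)).trans (t.val_map_neg hv).symm)⟩
  | and φ ψ ih₁ ih₂ =>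
    obtain ⟨s, hs⟩ := ih₁
    obtain ⟨t, ht⟩ := ih₂
    exact ⟨_, .of_isVal fun v hv => ((hs.and ht).val hv).trans <|
      hv.and.trans (s.val_and hv t).symm⟩
  | next φ ih =>
    obtain ⟨t, ht⟩ := ih
    exact ⟨_, .of_isVal fun v hv => (ht.next.val hv).trans (t.val_map_next hv).symm⟩
  | prev φ ih =>
    obtain ⟨t, ht⟩ := ih
    exact ⟨_, .of_isVal fun v hv => (ht.prev.val hv).trans (t.val_map_prev hv).symm⟩
  | con α φ ih =>
    obtain ⟨t, ht⟩ := ih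
    exact ⟨_, .of_isVal fun v hv => ((ht.con_right α).val hv).trans (t.val_con hv α).symm⟩

/-! ### Valuations along a timeline -/

/-- `Yⁿφ` -/
def Form.prevs (n : ℕ) (φ : Form AP) : Form AP := Form.prev^[n] φ

/-- `Xⁿφ` -/
def Form.nexts (n : ℕ) (φ : Form AP) : Form AP := Form.next^[n] φ

theorem Form.prevs_succ (n : ℕ) (φ : Form AP) :
    Form.prevs (n + 1) φ = Form.prevs n (.prev φ) := rfl

theorem Form.prevs_succ' (n : ℕ) (φ : Form AP) :
    Form.prevs (n + 1) φ = .prev (Form.prevs n φ) := Function.iterate_succ_apply' _ _ _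

theorem Form.nexts_succ (n : ℕ) (φ : Form AP) :
    Form.nexts (n + 1) φ = Form.nexts n (.next φ) := rfl

theorem Form.nexts_succ' (n : ℕ) (φ : Form AP) :
    Form.nexts (n + 1) φ = .next (Form.nexts n φ) := Function.iterate_succ_apply' _ _ _

/-- `Yⁿα` in `Φ_XY`. -/
def XY.prevs (n : ℕ) (α : XY AP) : XY AP := XY.prev^[n] α

theorem XY.toForm_prevs (n : ℕ) (α : XY AP) :
    (XY.prevs n α).toForm = Form.prevs n α.toForm := by
  induction n generalizing α with
  | zero => rfl
  | succ n ih => exact ih (.prev α)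

theorem ProvEquiv.prevs {φ ψ : Form AP} (h : ProvEquiv φ ψ) (n : ℕ) :
    ProvEquiv (Form.prevs n φ) (Form.prevs n ψ) := by
  induction n generalizing φ ψ with
  | zero => exact h
  | succ n ih => exact ih h.prev

theorem provEquiv_prevs_box (n : ℕ) (φ : Form AP) :
    ProvEquiv (Form.prevs n (.box φ)) (.box (Form.prevs n φ)) := by
  induction n generalizing φ with
  | zero => exact .of_isVal fun _ _ => Iff.rfl
  | succ n ih => exact ((provEquiv_prev_box φ).prevs n).trans (ih (.prev φ))

section Along

variable {v : Form AP → Prop}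

theorem IsVal.prevs (hv : IsVal v) {n : ℕ} (h : ¬ v (Form.prevs n .bot)) :
    IsVal fun φ => v (Form.prevs n φ) := by
  induction n generalizing v with
  | zero => exact hv
  | succ n ih =>
    have h₁ : ¬ v (.prev .bot) := fun hb => h <| by
      rw [Form.prevs_succ']; exact hv.prev_of_prev_bot hb _
    have := ih (hv.prev h₁) (by rwa [Form.prevs_succ'] at h)
    simpa only [Form.prevs_succ'] using this

theorem IsVal.nexts (hv : IsVal v) (n : ℕ) : IsVal fun φ => v (Form.nexts n φ) := by
  induction n generalizing v with
  | zero => exact hv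
  | succ n ih => simpa only [Form.nexts_succ'] using ih hv.next

theorem IsVal.not_prevs_bot_of_succ (hv : IsVal v) {n : ℕ}
    (h : ¬ v (Form.prevs (n + 1) .bot)) : ¬ v (Form.prevs n .bot) := by
  induction n generalizing v with
  | zero => exact hv.bot
  | succ n ih =>
    rw [Form.prevs_succ'] at h ⊢
    exact ih (hv.prev fun hb => h (hv.prev_of_prev_bot hb _)) h

/-- The value at the instant `k` of the timeline that is described by `v` from the instant `i`. -/
def along (v : Form AP → Prop) (i k : ℕ) (φ : Form AP) : Prop :=
  v (Form.prevs i (Form.nexts k φ))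

theorem IsVal.along (hv : IsVal v) {i : ℕ} (h : ¬ v (Form.prevs i .bot)) (k : ℕ) :
    IsVal (along v i k) :=
  (hv.prevs h).nexts k

theorem IsVal.along_prev (hv : IsVal v) {i : ℕ} (h : ¬ v (Form.prevs i .bot)) (k : ℕ)
    (φ : Form AP) : ConSHN.along v i (k + 1) (.prev φ) ↔ ConSHN.along v i k φ :=
  (hv.along h k).of_iff (.next_prev φ)

/-- With at least `i` instants of past, `Yⁱ` undoes `Xⁱ`, by the axiom for `YX` used below `Yⁿ`. -/
theorem IsVal.along_self (hv : IsVal v) {i : ℕ} (h : ¬ v (Form.prevs i .bot)) (φ : Form AP) :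
    ConSHN.along v i i φ ↔ v φ := by
  induction i with
  | zero => rfl
  | succ i ih =>
    have h' := hv.not_prevs_bot_of_succ h
    rw [← ih h']
    have hv' := hv.prevs h'
    have e := hv'.of_iff (.prev_next (Form.nexts i φ))
    rw [hv'.or] at e
    have hb : ¬ v (Form.prevs i (.prev .bot)) := h
    simp only [ConSHN.along, Form.prevs_succ, Form.nexts_succ'] at *
    tauto

/-- Step back until the past is exhausted, so that `i` is the exact instant, or until `N` steps are
made. -/
theorem IsVal.exists_instant (hv : IsVal v) (N : ℕ) :
    ∃ i, ¬ v (Form.prevs i .bot) ∧ (v (Form.prevs (i + 1) .bot) ∨ N ≤ i) := by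
  induction N with
  | zero => exact ⟨0, hv.bot, Or.inr le_rfl⟩
  | succ N ih =>
    obtain ⟨i, h₁, h₂⟩ := ih
    by_cases h : v (Form.prevs (i + 1) .bot)
    · exact ⟨i, h₁, Or.inl h⟩
    · exact ⟨i + 1, h, Or.inr (by rcases h₂ with h₂ | h₂ <;> [exact (h h₂).elim; omega])⟩

/-- Two valuations can describe timelines of the same model. -/
def Accessible (v v' : Form AP → Prop) : Prop := ∀ γ : XY AP, v (.box γ.toForm) → v' γ.toForm

theorem IsVal.accessible_self (hv : IsVal v) : Accessible v v := fun γ h =>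
  hv.imp.1 (hv.der (.box_imp γ)) h

/-- `Yⁿ⊥` speaks of the instant alone: `⊥` is equivalent to `□⊥`, and `□` commutes with `Y`. Hence
accessible valuations agree on these formulas. -/
theorem provEquiv_box_prevs_bot (n : ℕ) :
    ProvEquiv (Form.prevs n .bot : Form AP) (.box (Form.prevs n .bot)) :=
  (ProvEquiv.prevs (.of_isVal fun _ hv => iff_of_false hv.bot hv.not_box_bot) n).trans
    (provEquiv_prevs_box n .bot)

variable {v' : Form AP → Prop}

theorem Accessible.prevs_bot (h : Accessible v v') (hv : IsVal v) (n : ℕ)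
    (hb : v (Form.prevs n .bot)) : v' (Form.prevs n .bot) := by
  have := h (XY.prevs n .bot)
  rw [XY.toForm_prevs] at this
  exact this (((provEquiv_box_prevs_bot n).val hv).1 hb)

theorem Accessible.not_prevs_bot (h : Accessible v v') (hv : IsVal v) (hv' : IsVal v') (n : ℕ)
    (hb : ¬ v (Form.prevs n .bot)) : ¬ v' (Form.prevs n .bot) := by
  have e := h (.neg (XY.prevs n .bot))
  simp only [XY.toForm, XY.toForm_prevs, hv'.neg] at e
  refine e (((provEquiv_box_prevs_bot n).symm.neg.box.val hv).1 ?_)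
  have e' := hv.con_neg_box XY.top (XY.prevs n (.bot : XY AP))
  rw [XY.toForm_prevs] at e'
  refine e'.2 (Or.inr fun hc => hb ?_)
  have := hv.imp.1 (hv.accessible_self _ hc) hv.top
  rwa [XY.toForm_prevs] at this

/-- Propositional formulas that are true at the root are necessary there. -/
theorem IsVal.box_of_isPL (hv : IsVal v) (hb : v (.prev .bot)) {α : XY AP} (hα : α.IsPL)
    (h : v α.toForm) : v (.box α.toForm) := by
  -- The root axiom is used for `¬α`: at the root `◇¬α` would give `¬α`.
  have h₁ := hv.imp.1 (hv.der (.dia_prev_bot (.neg α) hα))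
  have h₂ : v (.dia (.prev .bot)) := hv.neg.2 fun hc =>
    hv.neg.1 (hv.accessible_self (.neg (.prev .bot)) hc) hb
  have h₃ := mt (hv.imp.1 (h₁ h₂)) fun hc => hv.neg.1 hc h
  rw [Form.dia, hv.neg, not_not] at h₃
  exact hv.con_mono _ (fun v hv => by simp only [XY.toForm, hv.neg, not_not, imp_self]) h₃

theorem Accessible.along_zero (h : Accessible v v') (hv : IsVal v) (hv' : IsVal v') {i : ℕ}
    (h₁ : ¬ v (Form.prevs i .bot)) (h₂ : v (Form.prevs (i + 1) .bot)) (p : AP) :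
    along v' i 0 (.atom p) ↔ along v i 0 (.atom p) := by
  have hu := hv.prevs h₁
  have hu' := hv'.prevs (h.not_prevs_bot hv hv' i h₁)
  have key : ∀ α : XY AP, α.IsPL → v (Form.prevs i α.toForm) → v' (Form.prevs i α.toForm) := by
    intro α hα hp
    have := ((provEquiv_prevs_box i α.toForm).val hv).1 (hu.box_of_isPL h₂ hα hp)
    rw [← XY.toForm_prevs] at this ⊢
    exact h _ this
  refine ⟨fun hp => ?_, key (.atom p) trivial⟩
  by_contra hc
  exact hu'.neg.1 (key (.neg (.atom p)) trivial (hu.neg.2 hc)) hp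

end Along

/-! ### The model -/

namespace Spider

/-- The states of a tree that branches at its root only: `some (j, k)` is the state of the
`j`-th branch at the instant `k + 1`. -/
inductive Rel : Option (ℕ × ℕ) → Option (ℕ × ℕ) → Prop
  | root (j : ℕ) : Rel none (some (j, 0))
  | step (j k : ℕ) : Rel (some (j, k)) (some (j, k + 1))

/-- The state of the `j`-th branch at the instant `k`. -/
def state (j : ℕ) : ℕ → Option (ℕ × ℕ)
  | 0 => none
  | k + 1 => some (j, k)

theorem rel_state (j k : ℕ) : Rel (state j k) (state j (k + 1)) := by
  cases k <;> constructor

theorem exists_state (x : Option (ℕ × ℕ)) : ∃ j k, state j k = x := by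
  rcases x with _ | ⟨j, k⟩
  · exact ⟨0, 0, rfl⟩
  · exact ⟨j, k + 1, rfl⟩

theorem rel_state_zero (j : ℕ) (x : Option (ℕ × ℕ)) : ¬ Rel x (state j 0) := nofun

theorem rel_state_succ {j k : ℕ} {x : Option (ℕ × ℕ)} (h : Rel x (state j (k + 1))) :
    x = state j k := by
  cases h <;> rfl

/-- Every state but the root has exactly one predecessor, so a path is determined from its end
backwards. -/
theorem existsUnique_path (x : ULift.{w} (Option (ℕ × ℕ))) :
    ∃! l : List (ULift.{w} (Option (ℕ × ℕ))),
      l.head? = some ⟨none⟩ ∧ l.getLast? = some x ∧ l.IsChain fun a b => Rel a.down b.down := by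
  obtain ⟨x⟩ := x
  obtain ⟨j, k, rfl⟩ := exists_state x
  induction k with
  | zero =>
    refine ⟨[⟨none⟩], ⟨rfl, rfl, by simp⟩, ?_⟩
    rintro l ⟨h₁, h₂, h₃⟩
    obtain ⟨l, rfl⟩ := List.getLast?_eq_some_iff.1 h₂
    rcases List.eq_nil_or_concat l with rfl | ⟨l, y, rfl⟩
    · rfl
    · exact (rel_state_zero j y.down ((List.isChain_append.1 h₃).2.2 y (by simp) _ rfl)).elim
  | succ k ih =>
    obtain ⟨l, ⟨h₁, h₂, h₃⟩, h₄⟩ := ih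
    refine ⟨l ++ [⟨state j (k + 1)⟩], ⟨by simp [h₁], by simp, ?_⟩, ?_⟩
    · refine List.isChain_append.2 ⟨h₃, by simp, ?_⟩
      intro y hy z hz
      rw [h₂] at hy
      cases hy
      cases hz
      exact rel_state j k
    · rintro l' ⟨h₁', h₂', h₃'⟩
      obtain ⟨l', rfl⟩ := List.getLast?_eq_some_iff.1 h₂'
      have hl' := List.isChain_append.1 h₃'
      congr 1
      rcases List.eq_nil_or_concat l' with rfl | ⟨l', y, rfl⟩
      · cases h₁'
      · have hy : y = ⟨state j k⟩ := by
          have := rel_state_succ (hl'.2.2 y (by simp) _ rfl)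
          exact ULift.ext _ _ this
        refine h₄ _ ⟨?_, by simp [hy], hl'.1⟩
        rwa [List.head?_append_of_ne_nil _ (by simp)] at h₁'

/-- The model that branches at its root only, with the given valuation of states. -/
def model (V : AP → Set (Option (ℕ × ℕ))) : Model.{u, w} AP where
  W := ULift (Option (ℕ × ℕ))
  rel a b := Rel a.down b.down
  serial := fun ⟨x⟩ => by
    obtain ⟨j, k, rfl⟩ := exists_state x
    exact ⟨⟨state j (k + 1)⟩, rel_state j k⟩
  root := ⟨none⟩
  existsUnique_path := existsUnique_path
  V p := ULift.down ⁻¹' V p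

variable {V : AP → Set (Option (ℕ × ℕ))}

/-- The `j`-th branch. -/
def branch (V : AP → Set (Option (ℕ × ℕ))) (j : ℕ) : (model.{u, w} V).Timeline :=
  ⟨fun k => ⟨state j k⟩, rfl, fun k => rel_state j k⟩

theorem eq_branch (π : (model.{u, w} V).Timeline) : ∃ j, π = branch V j := by
  obtain ⟨π, h₀, h⟩ := π
  have h₁ : Rel (π 0).down (π 1).down := h 0
  rw [h₀] at h₁
  generalize hx : (π 1).down = x at h₁
  obtain ⟨j, rfl⟩ : ∃ j, x = some (j, 0) := by
    cases h₁ with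
    | root j => exact ⟨j, rfl⟩
  refine ⟨j, Subtype.ext (funext fun k => ULift.ext _ _ ?_)⟩
  change (π k).down = state j k
  rcases k with _ | k
  · rw [h₀]; rfl
  · induction k with
    | zero => exact hx
    | succ k ih =>
      have h₂ : Rel (π (k + 1)).down (π (k + 1 + 1)).down := h (k + 1)
      rw [ih] at h₂
      generalize (π (k + 1 + 1)).down = y at h₂
      cases h₂
      rfl

end Spider

/-! ### Truth lemma and completeness -/

/-- The number of nested occurrences of `Y`. -/
def XY.depth : XY AP → ℕ
  | .atom _ => 0
  | .bot => 0
  | .neg α => α.depth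
  | .and α β => max α.depth β.depth
  | .next α => α.depth
  | .prev α => α.depth + 1

/-- The alternative in `hk` covers both kinds of past. Either instant 0 is a true beginning for `v`,
or `k` exceeds the depth of `α`, so that no `Y` leads back to the root and its atoms are irrelevant.
Accordingly `hzero` constrains the root in the first case only. -/
theorem XY.sat_branch {V : AP → Set (Option (ℕ × ℕ))} {j i : ℕ} {v : Form AP → Prop}
    (hv : IsVal v) (hi : ¬ v (Form.prevs i .bot))
    (hsucc : ∀ p k, some (j, k) ∈ V p ↔ along v i (k + 1) (.atom p))
    (hzero : v (Form.prevs (i + 1) .bot) → ∀ p, none ∈ V p ↔ along v i 0 (.atom p))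
    (α : XY AP) (k : ℕ) (hk : v (Form.prevs (i + 1) .bot) ∨ α.depth < k) :
    α.Sat (Spider.model.{u, w} V) (Spider.branch V j) k ↔ along v i k α.toForm := by
  induction α generalizing k with
  | atom p =>
    change Spider.state j k ∈ V p ↔ _
    rcases k with _ | k
    · exact hzero (hk.resolve_right (Nat.not_lt_zero _)) p
    · exact hsucc p k
  | bot => exact iff_of_false id (hv.along hi k).bot
  | neg α ih => exact (not_congr (ih k hk)).trans (hv.along hi k).neg.symm
  | and α β ih₁ ih₂ =>
    exact (and_congr (ih₁ k (hk.imp_right (lt_of_le_of_lt (le_max_left _ _))))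
      (ih₂ k (hk.imp_right (lt_of_le_of_lt (le_max_right _ _))))).trans (hv.along hi k).and.symm
  | next α ih => exact ih (k + 1) (hk.imp_right Nat.lt_succ_of_lt)
  | prev α ih =>
    rcases k with _ | k
    · refine iff_of_true (fun h => (lt_irrefl _ h).elim) ?_
      have hb := hk.resolve_right (Nat.not_lt_zero _)
      exact (hv.along hi 0).prev_of_prev_bot hb _
    · have := ih k (hk.imp_right Nat.lt_of_succ_lt_succ)
      simp only [XY.Sat, Nat.succ_pos, true_imp_iff, Nat.add_sub_cancel, XY.toForm]
      rw [this, hv.along_prev hi]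

namespace Tree

/-- The tests of a decision tree. -/
def tests : Tree AP → List (XY AP)
  | leaf _ => []
  | node β s t => β :: (s.tests ++ t.tests)

/-- A bound of the depths of the leaves and tests of a decision tree. -/
def depth : Tree AP → ℕ
  | leaf γ => γ.depth
  | node β s t => max β.depth (max s.depth t.depth)

theorem sat_iff_val {M : Model.{u, w} AP} {C : M.Context} {π : M.Timeline} {i : ℕ}
    {v : Form AP → Prop} (hv : IsVal v) (t : Tree AP)
    (hx : ∀ γ : XY AP, γ.depth ≤ t.depth → (γ.Sat M π i ↔ v γ.toForm))
    (hb : ∀ β ∈ t.tests, β.depth ≤ t.depth →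
      ((Form.box β.toForm).Sat M C π i ↔ v (.box β.toForm))) :
    t.toForm.Sat M C π i ↔ v t.toForm := by
  induction t with
  | leaf γ => exact (γ.sat_toForm M C π i).trans (hx γ le_rfl)
  | node β s t ihs iht =>
    simp only [depth, tests] at hx hb
    rw [val_node hv, ← ihs (fun γ h => hx γ (by omega))
        (fun γ hγ h => hb γ (by simp [hγ]) (by omega)),
      ← iht (fun γ h => hx γ (by omega)) (fun γ hγ h => hb γ (by simp [hγ]) (by omega)),
      ← hb β (by simp) (by omega)]
    simp only [toForm, Form.Sat, Form.sat_or]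
    tauto

end Tree

/-- A sequence of valuations that witnesses the falsity of the false ones among the formulas `□β`
for `β` in a list. -/
theorem IsVal.exists_witnesses {v : Form AP → Prop} (hv : IsVal v) (B : List (XY AP)) :
    ∃ u : ℕ → Form AP → Prop, u 0 = v ∧ (∀ j, IsVal (u j)) ∧ (∀ j, Accessible v (u j)) ∧
      ∀ β ∈ B, (∀ j, u j β.toForm) → v (.box β.toForm) := by
  induction B with
  | nil => exact ⟨fun _ => v, rfl, fun _ => hv, fun _ => hv.accessible_self, by simp⟩
  | cons β B ih =>
    obtain ⟨u, h₀, h₁, h₂, h₃⟩ := ih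
    by_cases hβ : v (.box β.toForm)
    · exact ⟨u, h₀, h₁, h₂, by simpa [hβ] using h₃⟩
    · obtain ⟨v', hv', ha, hn⟩ := (isTheory_box hv).exists_isVal hβ
      -- The new witness is inserted at index 1, keeping `v` at index 0 and shifting the other
      -- witnesses by one.
      refine ⟨fun j => if j = 0 then v else if j = 1 then v' else u (j - 1), rfl, ?_, ?_, ?_⟩
      · intro j; dsimp only; split_ifs <;> [exact hv; exact hv'; exact h₁ _]
      · intro j; dsimp only
        split_ifs <;> [exact hv.accessible_self; exact fun γ h => ha _ h; exact h₂ _]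
      · intro γ hγ h
        rcases List.mem_cons.1 hγ with rfl | hγ
        · exact (hn (h 1)).elim
        · refine h₃ γ hγ fun j => ?_
          rcases j with _ | j
          · rw [h₀]; exact h 0
          · exact h (j + 2)

theorem Valid.derivable {φ : Form AP} (hφ : Valid.{u, w} φ) : Derivable φ := by
  refine derivable_of_forall_isVal fun v hv => ?_
  obtain ⟨t, ht⟩ := φ.exists_tree
  obtain ⟨u, h₀, hu, hacc, hwit⟩ := hv.exists_witnesses t.tests
  obtain ⟨i, hi, hi'⟩ := hv.exists_instant (t.depth + 1)
  -- The root is shared by all branches and takes its atoms from `v`. This suits every branch when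
  -- `i` is the exact instant, and is never consulted otherwise.
  let V : AP → Set (Option (ℕ × ℕ)) := fun p =>
    {x | x.elim (along v i 0 (.atom p)) fun y => along (u y.1) i (y.2 + 1) (.atom p)}
  have hui := fun j => (hacc j).not_prevs_bot hv (hu j) i hi
  have truth : ∀ (j : ℕ) (γ : XY AP), γ.depth ≤ t.depth →
      (γ.Sat (Spider.model.{_, w} V) (Spider.branch V j) i ↔ u j γ.toForm) := by
    intro j γ hγ
    have hk : u j (Form.prevs (i + 1) .bot) ∨ γ.depth < i :=
      hi'.imp ((hacc j).prevs_bot hv (i + 1)) fun h => by omega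
    rw [γ.sat_branch (hu j) (hui j) (fun p k => Iff.rfl) (fun h p => ?_) i hk,
      (hu j).along_self (hui j)]
    have hb : v (Form.prevs (i + 1) .bot) := by
      by_contra hc
      exact (hacc j).not_prevs_bot hv (hu j) (i + 1) hc h
    exact ((hacc j).along_zero hv (hu j) hi hb p).symm
  let C : (Spider.model.{_, w} V).Context := ⟨∅, Set.finite_empty⟩
  have hC : ∀ π, π ∈ C.AT := fun π => by simp [C, Model.Context.AT]
  -- Soundness carries the truth of `φ` in this model over to its decision tree.
  have hsat := Derivable.valid.{_, w} ht
  have hsat := Form.sat_iff.1 (hsat (Spider.model.{_, w} V) C (Spider.branch V 0) i (hC _))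
  refine (ht.val hv).2 ((t.sat_iff_val hv ?_ ?_).1
    (hsat.1 (hφ (Spider.model.{_, w} V) C (Spider.branch V 0) i (hC _))))
  · exact fun γ hγ => h₀ ▸ truth 0 γ hγ
  · intro β hβ hd
    rw [Form.sat_box_xy]
    constructor
    · exact fun h => hwit β hβ fun j => (truth j β hd).1 (h _ (hC _))
    · intro h π _
      obtain ⟨j, rfl⟩ := Spider.eq_branch π
      exact (truth j β hd).2 (hacc j β h)

end ConSHN

theorem theorem1 {AP : Type u} [Countable AP] (φ : ConSHN.Form AP) :
    ConSHN.Derivable φ ↔ ConSHN.Valid.{u, w} φ :=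
  ⟨fun h => h.valid, fun h => h.derivable⟩
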